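/- Let $G$ be a finite directed acyclic graph (DAG) on vertex set $V$. In $\mathbb{R}^V$ with standard basis $(e_v)_{v\in V}$ put $e_{ij}=e_i-e_j$, let $A_G=\{0\}\cup\{e_{ij} : j\to i \text{ is an edge of } G\}$, and let $P_G=\operatorname{conv}(A_G)$ be the root polytope of $G$. A height function $h\colon A_G\to\mathbb{R}$ induces the regular subdivision of $P_G$ whose cells are the projections of the nonempty lower faces of $\operatorname{conv}\{(a,h(a)) : a\in A_G\}$, that is, the polytopes $\operatorname{conv}\{a\in A_G : \ell(a)=h(a)\}$, where $\ell$ ranges over the affine functions with $\ell\le h$ on $A_G$ and with equality at some point of $A_G$. A subdivision is central if the origin lies in each of its maximal cells. A set cover of a subdivision $\Sigma$ of $P_G$ is a finite set of cells of $\Sigma$ such that every $e_{ij}$ with $j\to i$ an edge of $G$ lies in at least one of them; the set cover number $c(\Sigma)$ is the minimum number of cells in a set cover of $\Sigma$. The minimum sample size of $G$ is $$c(G)=\max\{\,c(\Sigma) : \Sigma \text{ is a regular central subdivision of } P_G\,\}.$$ **Lemma.** Let $H$ and $G$ be finite DAGs such that $H\subseteq G$, i.e. $H$ is a subgraph of $G$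 (or, more generally, there is an injective map from the vertices of $H$ to the vertices of $G$ that sends every edge of $H$ to an edge of $G$). Then $c(H)\le c(G)$. -/

import Mathlib

namespace RootPolytope

/-- A digraph is acyclic (a DAG) if no vertex can be reached from itself along a directed walk
of positive length. -/
def IsDAG {V : Type*} (G : Digraph V) : Prop :=
  ∀ v, ¬ Relation.TransGen G.Adj v v

/-- The vector `e i j = e_i - e_j` in `ℝ^V`. -/
def e {V : Type*} [DecidableEq V] (i j : V) : V → ℝ :=
  Pi.single i 1 - Pi.single j 1

/-- The vectors `e_i - e_j`, one for every edge `j → i` of `G`. -/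
def roots {V : Type*} [DecidableEq V] (G : Digraph V) : Set (V → ℝ) :=
  {x | ∃ i j, G.Adj j i ∧ x = e i j}

/-- The point configuration whose convex hull is the root polytope
`P_G = conv ({0} ∪ {e_i - e_j | j → i})`. For a DAG these points are exactly the vertices
of `P_G`. -/
def points {V : Type*} [DecidableEq V] (G : Digraph V) : Set (V → ℝ) :=
  {0} ∪ roots G

/-- The subdivision of `conv A` induced by the height function `h` on the finite point set `A`.
Its cells are the projections of the nonempty lower faces of the lifted polytope
`conv {(a, h a) | a ∈ A}`: an affine function `l` that lies weakly below all the heights and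
touches some of them supports such a face, and the face projects to the convex hull of the points
whose height is touched. Cells of all dimensions are listed. -/
def inducedSubdivision {E : Type*} [AddCommGroup E] [Module ℝ E] (A : Set E) (h : E → ℝ) :
    Set (Set E) :=
  {σ | ∃ l : E →ᵃ[ℝ] ℝ, (∀ a ∈ A, l a ≤ h a) ∧ (∃ a ∈ A, l a = h a) ∧
    σ = convexHull ℝ {a | a ∈ A ∧ l a = h a}}

/-- `S` is a regular subdivision of the root polytope of `G`: it is induced by heights on
the points that span the polytope. -/
def IsRegularSubdivision {V : Type*} [DecidableEq V] (G : Digraph V) (S : Set (Set (V → ℝ))) :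
    Prop :=
  ∃ h : (V → ℝ) → ℝ, S = inducedSubdivision (points G) h

/-- A subdivision is central if the origin lies in every maximal cell. -/
def IsCentral {E : Type*} [Zero E] (S : Set (Set E)) : Prop :=
  ∀ σ, Maximal (· ∈ S) σ → (0 : E) ∈ σ

/-- `T` is a set cover of the subdivision `S` of the root polytope of `G`: a finite collection of
cells such that every `e_i - e_j` with `j → i` an edge of `G` lies in one of them. -/
def IsSetCover {V : Type*} [DecidableEq V] (G : Digraph V) (S : Set (Set (V → ℝ)))
    (T : Finset (Set (V → ℝ))) : Prop :=
  (∀ σ ∈ T, σ ∈ S) ∧ ∀ x ∈ roots G, ∃ σ ∈ T, x ∈ σ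

/-- The set cover number `c(S)`: the least number of cells in a set cover of `S`
(it would be `⊤` if there were no set cover). -/
noncomputable def setCoverNumber {V : Type*} [DecidableEq V] (G : Digraph V)
    (S : Set (Set (V → ℝ))) : ℕ∞ :=
  ⨅ (T : Finset (Set (V → ℝ))) (_ : IsSetCover G S T), (T.card : ℕ∞)

/-- The minimum sample size `c(G)`: the largest set cover number of a regular central
subdivision of the root polytope of `G`. -/
noncomputable def minimumSampleSize {V : Type*} [DecidableEq V] (G : Digraph V) : ℕ∞ :=
  ⨆ (S : Set (Set (V → ℝ))) (_ : IsRegularSubdivision G S ∧ IsCentral S), setCoverNumber G S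

end RootPolytope

namespace RootPolytope

section Central

variable {E : Type*} [AddCommGroup E] [Module ℝ E]

/-! Given heights `h` on the points of `H`, transport them to `G` along restriction of coordinates
and push the height of the origin far down. Low origin forces centrality: an affine function
touching only a set `F` without 0 either has its value at 0 determined by `F` (finitely many values,
all undercut) or can be tilted to touch more. A supporting function for `G`, composed with `extend
f`, stays below `h` and touches the same edges of `H`, so a set cover for `G` pulls back to one for
`H` that is no larger. -/

/-- A point outside the affine span of a nonempty set is separated from it by an affine function
that vanishes on the set. -/
lemma exists_affineMap_eqOn_zero {F : Set E} (hF : F.Nonempty) {x : E}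
    (hx : x ∉ affineSpan ℝ F) :
    ∃ m : E →ᵃ[ℝ] ℝ, (∀ a ∈ F, m a = 0) ∧ 0 < m x := by
  obtain ⟨p, hp⟩ := hF
  have hpF : p ∈ affineSpan ℝ F := subset_affineSpan ℝ F hp
  have hxp : x - p ∉ (affineSpan ℝ F).direction := fun h => by
    apply hx
    have := AffineSubspace.vadd_mem_of_mem_direction h hpF
    simpa using this
  obtain ⟨g, hg, hker⟩ := Submodule.exists_le_ker_of_notMem hxp
  have key : ∀ a ∈ F, g (a - p) = 0 := fun a ha =>
    hker (AffineSubspace.vsub_mem_direction (subset_affineSpan ℝ F ha) hpF)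
  -- The factor `g (x - p)` fixes the sign: the value at `x` is its square.
  refine ⟨(g (x - p)) • (g.toAffineMap - AffineMap.const ℝ E (g p)), fun a ha => ?_, ?_⟩
  · have := key a ha
    rw [map_sub] at this
    simp [this]
  · have : (0 : ℝ) < g (x - p) * g (x - p) := mul_self_pos.2 hg
    simpa [map_sub] using this

/-- If an affine function below the heights touches them only along a set whose affine span misses
some point of `A`, then it can be tilted so as to touch more points. -/
lemma exists_tilt {A : Set E} (hA : A.Finite) {h : E → ℝ} {l m : E →ᵃ[ℝ] ℝ}
    (hl : ∀ a ∈ A, l a ≤ h a) {x : E} (hx : x ∈ A) (hmx : 0 < m x) :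
    ∃ s : ℝ, (∀ a ∈ A, (l + s • m) a ≤ h a) ∧ ∃ a ∈ A, 0 < m a ∧ (l + s • m) a = h a := by
  obtain ⟨b, ⟨hbA, hmb⟩, hb⟩ := Set.exists_min_image {a | a ∈ A ∧ 0 < m a}
    (fun a => (h a - l a) / m a) (hA.subset fun _ h => h.1) ⟨x, hx, hmx⟩
  refine ⟨(h b - l b) / m b, fun a ha => ?_, b, hbA, hmb, ?_⟩
  · have hs : 0 ≤ (h b - l b) / m b := div_nonneg (sub_nonneg.2 (hl b hbA)) hmb.le
    simp only [AffineMap.coe_add, AffineMap.coe_smul, Pi.add_apply, Pi.smul_apply,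
      smul_eq_mul]
    rcases lt_or_ge 0 (m a) with hma | hma
    · have := (le_div_iff₀ hma).1 (hb a ⟨ha, hma⟩)
      linarith
    · have := mul_nonpos_of_nonneg_of_nonpos hs hma
      linarith [hl a ha]
  · simp only [AffineMap.coe_add, AffineMap.coe_smul, Pi.add_apply, Pi.smul_apply,
      smul_eq_mul]
    rw [div_mul_cancel₀ _ hmb.ne']
    ring

/-- The subdivision of a finite configuration is central once the height of the origin is low
enough. -/
lemma exists_isCentral_of_le {A : Set E} (hA : A.Finite) (h0 : (0 : E) ∈ A) (h : E → ℝ) :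
    ∃ N : ℝ, ∀ h' : E → ℝ, (∀ a, a ≠ 0 → h' a = h a) → h' 0 ≤ N →
      IsCentral (inducedSubdivision A h') := by
  -- `b F` depends on `h` alone, so the bound is uniform in `h'`.
  have hb : ∀ F : Set E, ∃ b : ℝ, (0 : E) ∈ affineSpan ℝ F →
      ∀ l : E →ᵃ[ℝ] ℝ, (∀ a ∈ F, l a = h a) → l 0 = b := by
    intro F
    by_cases hF : ∃ l : E →ᵃ[ℝ] ℝ, ∀ a ∈ F, l a = h a
    · obtain ⟨l₀, hl₀⟩ := hF
      refine ⟨l₀ 0, fun h0F l hl => ?_⟩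
      have : Set.EqOn l l₀ (affineSpan ℝ F) :=
        AffineMap.eqOn_affineSpan fun a ha => (hl a ha).trans (hl₀ a ha).symm
      exact this h0F
    · exact ⟨0, fun _ l hl => (hF ⟨l, hl⟩).elim⟩
  choose b hb using hb
  obtain ⟨N, hN⟩ := (hA.finite_subsets.image b).bddBelow
  -- The `- 1` makes `h' 0 < b F` strict, contradicting `l 0 ≤ h' 0`.
  refine ⟨N - 1, fun h' hh' hle σ hσ => ?_⟩
  obtain ⟨l, hl, ⟨p, hpA, hp⟩, rfl⟩ := hσ.prop
  by_cases hl0 : l 0 = h' 0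
  · exact subset_convexHull ℝ _ ⟨h0, hl0⟩
  exfalso
  set F : Set E := {a | a ∈ A ∧ l a = h' a} with hFdef
  have hF0 : ∀ a ∈ F, a ≠ 0 := by
    rintro a ha rfl
    exact hl0 ha.2
  by_cases hspan : (0 : E) ∈ affineSpan ℝ F
  · have h1 := hb F hspan l fun a ha => ha.2.trans (hh' a (hF0 a ha))
    have h2 := hN ⟨F, fun a ha => ha.1, rfl⟩
    linarith [hl 0 h0]
  · obtain ⟨m, hmF, hm0⟩ := exists_affineMap_eqOn_zero (F := F) ⟨p, hpA, hp⟩ hspan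
    obtain ⟨s, hs, a, haA, hma, ha⟩ := exists_tilt hA hl h0 hm0
    have hsub : F ⊆ {a | a ∈ A ∧ (l + s • m) a = h' a} := fun c hc => by
      refine ⟨hc.1, ?_⟩
      simp [hmF c hc, hc.2]
    have hle' := hσ.le_of_ge ⟨l + s • m, hs, ⟨a, haA, ha⟩, rfl⟩ (convexHull_mono hsub)
    have haF : a ∈ convexHull ℝ F := hle' (subset_convexHull ℝ _ ⟨haA, ha⟩)
    have hmspan : Set.EqOn m (AffineMap.const ℝ E (0 : ℝ)) (affineSpan ℝ F) :=
      AffineMap.eqOn_affineSpan fun c hc => by simpa using hmF c hc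
    have := hmspan (convexHull_subset_affineSpan F haF)
    simp only [AffineMap.const_apply] at this
    linarith

end Central

section Roots

variable {V W : Type*}

lemma IsDAG.ne {G : Digraph V} (hG : IsDAG G) {i j : V} (h : G.Adj j i) : i ≠ j := by
  rintro rfl
  exact hG i (.single h)

/-- The linear map `ℝ^W → ℝ^V` that sends `e_w` to `e_(f w)`. -/
noncomputable def extend (f : W ↪ V) : (W → ℝ) →ₗ[ℝ] (V → ℝ) :=
  Function.ExtendByZero.linearMap ℝ f

lemma extend_comp (f : W ↪ V) (x : W → ℝ) : extend f x ∘ f = x := by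
  funext w
  simp [extend, f.injective.extend_apply]

variable [DecidableEq V] [DecidableEq W]

lemma finite_points [Finite V] (G : Digraph V) : (points G).Finite := by
  refine (Set.finite_singleton _).union
    ((Set.finite_range fun p : V × V => e p.1 p.2).subset ?_)
  rintro x ⟨i, j, -, rfl⟩
  exact ⟨(i, j), rfl⟩

lemma e_ne_zero {i j : V} (hij : i ≠ j) : e i j ≠ 0 := fun h => by
  have := congrFun h i
  simp [e, hij] at this

/-- The points of the configuration are in convex position at every `e i j`. -/
lemma mem_of_e_mem_convexHull {G : Digraph V} {F : Set (V → ℝ)} (hF : F ⊆ points G) {i j : V}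
    (hij : i ≠ j) (h : e i j ∈ convexHull ℝ F) : e i j ∈ F := by
  by_contra hn
  -- The functional `z i - z j` is 2 at `e i j` and at most 1 at every other point.
  have hsub : F ⊆ {z : V → ℝ | z i - z j ≤ 1} := by
    intro z hz
    rcases hF hz with rfl | ⟨k, l, -, rfl⟩
    · simp
    · have hkl : ¬ (i = k ∧ j = l) := by
        rintro ⟨rfl, rfl⟩
        exact hn hz
      simp only [e, Set.mem_ofPred_eq, Pi.sub_apply, Pi.single_apply]
      by_cases h1 : i = k <;> by_cases h2 : j = l <;> simp only [h1, h2, true_and, and_true,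
        not_true_eq_false, if_true, if_false] at hkl ⊢ <;> split_ifs <;> norm_num
  have hconv : Convex ℝ {z : V → ℝ | z i - z j ≤ 1} :=
    convex_halfSpace_le (f := fun z : V → ℝ => z i - z j)
      (LinearMap.proj (R := ℝ) (φ := fun _ : V => ℝ) i - LinearMap.proj j).isLinear 1
  have := convexHull_min hsub hconv h
  simp only [e, Set.mem_ofPred_eq, Pi.sub_apply, Pi.single_apply, if_true, hij, hij.symm,
    if_false] at this
  norm_num at this

lemma extend_single (f : W ↪ V) (w : W) :
    extend f (Pi.single w 1) = Pi.single (f w) 1 := by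
  funext v
  by_cases hv : ∃ w', f w' = v
  · obtain ⟨w', rfl⟩ := hv
    simp [extend, f.injective.extend_apply, Pi.single_apply]
  · have : v ≠ f w := fun h => hv ⟨w, h.symm⟩
    simp [extend, Function.extend_apply' _ _ _ hv, this]

lemma extend_e (f : W ↪ V) (i j : W) : extend f (e i j) = e (f i) (f j) := by
  simp [e, extend_single]

lemma extend_mem_roots {G : Digraph V} {H : Digraph W} {f : W ↪ V}
    (hf : ∀ u v : W, H.Adj u v → G.Adj (f u) (f v)) {x : W → ℝ} (hx : x ∈ roots H) :
    extend f x ∈ roots G := by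
  obtain ⟨i, j, hij, rfl⟩ := hx
  exact ⟨f i, f j, hf _ _ hij, extend_e f i j⟩

/-- If the heights on `G` agree with those on `H` along the edges of `H` and are no higher at the
origin, then the edges of `H` in a cell for `G` lie in a common cell for `H`. -/
lemma exists_cell_of_cell {G : Digraph V} {H : Digraph W} (hH : IsDAG H) {f : W ↪ V}
    (hf : ∀ u v : W, H.Adj u v → G.Adj (f u) (f v)) {g : (V → ℝ) → ℝ} {h : (W → ℝ) → ℝ}
    (hroots : ∀ x ∈ roots H, g (extend f x) = h x) (hzero : g 0 ≤ h 0)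
    {σ : Set (V → ℝ)} (hσ : σ ∈ inducedSubdivision (points G) g) :
    ∃ τ : Set (W → ℝ), ∀ x ∈ roots H, extend f x ∈ σ →
      τ ∈ inducedSubdivision (points H) h ∧ x ∈ τ := by
  obtain ⟨l, hl, -, rfl⟩ := hσ
  let l' : (W → ℝ) →ᵃ[ℝ] ℝ := l.comp (extend f).toAffineMap
  refine ⟨convexHull ℝ {a | a ∈ points H ∧ l' a = h a}, fun x hx hxσ => ?_⟩
  have hle : ∀ a ∈ points H, l' a ≤ h a := by
    rintro a (rfl | ha)
    · simpa [l'] using (hl 0 (Or.inl rfl)).trans hzero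
    · exact (hl _ (Or.inr (extend_mem_roots hf ha))).trans (hroots a ha).le
  have hxl : l' x = h x := by
    rw [← hroots x hx]
    obtain ⟨i, j, hij, rfl⟩ := hx
    rw [extend_e] at hxσ
    have := mem_of_e_mem_convexHull (fun a ha => ha.1)
      (f.injective.ne (hH.ne hij)) hxσ
    simpa [l', extend_e] using this.2
  exact ⟨⟨l', hle, ⟨x, Or.inr hx, hxl⟩, rfl⟩, subset_convexHull ℝ _ ⟨Or.inr hx, hxl⟩⟩

lemma setCoverNumber_le_of_cells {G : Digraph V} {H : Digraph W} {f : W ↪ V}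
    (hf : ∀ u v : W, H.Adj u v → G.Adj (f u) (f v))
    {S : Set (Set (W → ℝ))} {S' : Set (Set (V → ℝ))}
    (hcell : ∀ σ ∈ S', ∃ τ : Set (W → ℝ), ∀ x ∈ roots H, extend f x ∈ σ → τ ∈ S ∧ x ∈ τ) :
    setCoverNumber H S ≤ setCoverNumber G S' := by
  classical
  choose! c hc using hcell
  refine le_iInf₂ fun T hT => ?_
  -- If `σ` contains no edge of `H`, `c σ` need not be a cell; the filter drops it.
  have hT' : IsSetCover H S ((T.image c).filter (· ∈ S)) := by
    refine ⟨fun σ hσ => (Finset.mem_filter.1 hσ).2, fun x hx => ?_⟩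
    obtain ⟨σ, hσT, hxσ⟩ := hT.2 _ (extend_mem_roots hf hx)
    obtain ⟨hS, hxc⟩ := hc σ (hT.1 σ hσT) x hx hxσ
    exact ⟨c σ, Finset.mem_filter.2 ⟨Finset.mem_image_of_mem c hσT, hS⟩, hxc⟩
  refine (iInf₂_le _ hT').trans ?_
  exact_mod_cast (Finset.card_filter_le _ _).trans Finset.card_image_le

end Roots

end RootPolytope

open RootPolytope in
theorem mainTheorem5 {V W : Type*} [Fintype V] [DecidableEq V] [Fintype W] [DecidableEq W]
    (G : Digraph V) (H : Digraph W)
    (hG : RootPolytope.IsDAG G) (hH : RootPolytope.IsDAG H)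
    (f : W ↪ V) (hf : ∀ u v : W, H.Adj u v → G.Adj (f u) (f v)) :
    RootPolytope.minimumSampleSize H ≤ RootPolytope.minimumSampleSize G := by
  classical
  refine iSup₂_le fun S hS => ?_
  obtain ⟨⟨h, rfl⟩, -⟩ := hS
  obtain ⟨N, hN⟩ := exists_isCentral_of_le (finite_points G) (Or.inl rfl) fun x => h (x ∘ f)
  -- At most `N` for centrality, at most `h 0` for pulling cells back.
  let g : (V → ℝ) → ℝ := Function.update (fun x => h (x ∘ f)) 0 (min N (h 0))
  have hcentral : IsCentral (inducedSubdivision (points G) g) :=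
    hN g (fun a ha => Function.update_of_ne ha _ _) (by simp [g])
  have hroots : ∀ x ∈ roots H, g (extend f x) = h x := by
    rintro x ⟨i, j, hij, rfl⟩
    have hne : extend f (e i j) ≠ 0 := by
      rw [extend_e]
      exact e_ne_zero (f.injective.ne (hH.ne hij))
    simp only [g, Function.update_of_ne hne, extend_comp]
  refine le_iSup₂_of_le (inducedSubdivision (points G) g) ⟨⟨g, rfl⟩, hcentral⟩ ?_
  exact setCoverNumber_le_of_cells hf fun σ hσ =>
    exists_cell_of_cell hH hf hroots (by simp [g]) hσ
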